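/- **Proposition (NNGP correspondence for vanilla GCN).** Let $\mathcal G$ be a finite simple undirected graph with $n$ nodes, adjacency matrix $A$ and degree matrix $D$, and let $\hat A=(D+I)^{-1/2}(A+I)(D+I)^{-1/2}$. Let $X\in\mathbb R^{n\times d_0}$ and let $\sigma:\mathbb R\to\mathbb R$ be continuous with $\mathbb E[\sigma(z)^2]<\infty$ for every centered Gaussian variable $z$. The vanilla GCN with $L$ layers of widths $d_1,\dots,d_L$ is $X^{(0)}=X$, $H^{(l)}=\hat A X^{(l-1)}W^{(l)}+\mathbf 1_n b^{(l)}$, $X^{(l)}=\sigma(H^{(l)})$ (entrywise), with $W^{(l)}\in\mathbb R^{d_{l-1}\times d_l}$. At initialization $b^{(l)}=0$, all entries of all $W^{(l)}$ are independent, and all entries of $\sqrt{d_{l-1}}\,W^{(l)}$ have a common law $\nu_l$ that does not depend on the widths and has mean $0$ and variance $\sigma_w^2$. For a positive semi-definite $\Sigma\in\mathbb R^{n\times n}$ put $G(\Sigma)=\mathbb E_{h\sim N(0,\Sigma)}[\sigma(h)\sigma(h)^T]$, and define $$\Sigma^{(1)}=\frac{\sigma_w^2}{d_0}\hat A XX^T\hat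 A,\qquad \Sigma^{(l+1)}=\sigma_w^2\,\hat A\,G(\Sigma^{(l)})\,\hat A\quad(l\ge 1).$$ By convergence as $d_1,\dots,d_{l-1}$ *sequentially go to infinity* we mean the iterated weak limit of the laws: first $d_1\to\infty$ with all other widths fixed, then $d_2\to\infty$, and so on up to $d_{l-1}\to\infty$, all intermediate limits existing. 1. Suppose that the weights of the first layer are Gaussian, $\nu_1=N(0,\sigma_w^2)$. Then for every $2\le l\le L$ and all fixed $d_l,\dots,d_L$, the matrix $\Sigma^{(l)}$ is positive semi-definite and, as $d_1,\dots,d_{l-1}$ sequentially go to infinity, the channels $(H^{(l)}_{:,k})_{k\le d_l}$ converge jointly in distribution to $d_l$ independent $N(0,\Sigma^{(l)})$ vectors. 2. For arbitrary $\nu_1$, let $\mu_1$ be the law of $\hat A X\xi/\sqrt{d_0}$, where $\xi$ has $d_0$ independent coordinates of law $\nu_1$, and suppose that $\mathbb E_{h\sim\mu_1}[\sigma(h_i)^2]<\infty$ for every node $i$. Then the conclusion of part 1 holds with $\Sigma^{(l)}$ replaced by $\bar\Sigma^{(l)}$, where $\bar\Sigma^{(2)}=\sigma_w^2\,\hat A\,\mathbb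 E_{h\sim\mu_1}[\sigma(h)\sigma(h)^T]\,\hat A$ and $\bar\Sigma^{(l+1)}=\sigma_w^2\,\hat A\,G(\bar\Sigma^{(l)})\,\hat A$ for $l\ge 2$. 3. For all widths, and any $\nu_1$, the channels of $H^{(1)}$ are independent with law $\mu_1$, and $\mu_1$ has mean $0$ and covariance matrix $\Sigma^{(1)}$. -/

import Mathlib

open MeasureTheory ProbabilityTheory Filter Topology Matrix

noncomputable section

/-- The normalized adjacency matrix `D̃^{-1/2} (A + I) D̃^{-1/2}` of a graph, where `A` is the
adjacency matrix, `D` the diagonal matrix of degrees and `D̃ = D + I`. -/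
def normalizedAdj {V : Type*} [Fintype V] [DecidableEq V] (𝒢 : SimpleGraph V)
    [DecidableRel 𝒢.Adj] : Matrix V V ℝ :=
  Matrix.diagonal (fun v => (√((𝒢.degree v : ℝ) + 1))⁻¹) * (𝒢.adjMatrix ℝ + 1) *
    Matrix.diagonal (fun v => (√((𝒢.degree v : ℝ) + 1))⁻¹)

/-- Layer widths of a network: layer `0` (the input) has width `d₀`, and layer `j + 1` has
width `d j`. -/
def layerWidth (d₀ : ℕ) (d : ℕ → ℕ) : ℕ → ℕ
  | 0 => d₀
  | j + 1 => d j

/-- One graph convolution `A Y W + 1 b` with `m'` input channels and `m` output channels. -/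
def gcnLayer {V : Type*} [Fintype V] {m' m : ℕ} (A : Matrix V V ℝ) (Y : Matrix V (Fin m') ℝ)
    (W : Matrix (Fin m') (Fin m) ℝ) (b : Fin m → ℝ) : Matrix V (Fin m) ℝ :=
  A * Y * W + Matrix.of (fun _ k => b k)

/-- Pre-activation embeddings of the vanilla graph convolutional network with aggregation
matrix `A`, input features `X`, entrywise activation `σ`, weights `W` and biases `b`:
`H⁽ˡ⁾ = A X⁽ˡ⁻¹⁾ W⁽ˡ⁾ + 1 b⁽ˡ⁾`, `X⁽ˡ⁾ = σ(H⁽ˡ⁾)`, `X⁽⁰⁾ = X`.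
The layers `1, 2, …` are numbered from `0` here: `gcnPreact … l` is `H⁽ˡ⁺¹⁾`, and `W l`, `b l` are
the weight matrix and the bias of layer `l + 1`. -/
def gcnPreact {V : Type*} [Fintype V] {d₀ : ℕ} (A : Matrix V V ℝ) (X : Matrix V (Fin d₀) ℝ)
    (σ : ℝ → ℝ) (d : ℕ → ℕ)
    (W : (l : ℕ) → Matrix (Fin (layerWidth d₀ d l)) (Fin (layerWidth d₀ d (l + 1))) ℝ)
    (b : (l : ℕ) → Fin (layerWidth d₀ d (l + 1)) → ℝ) :
    (l : ℕ) → Matrix V (Fin (layerWidth d₀ d (l + 1))) ℝ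
  | 0 => gcnLayer A X (W 0) (b 0)
  | l + 1 => gcnLayer A ((gcnPreact A X σ d W b l).map σ) (W (l + 1)) (b (l + 1))

/-- The `k`-th channel (column) of an embedding matrix, as a vector of the Euclidean space. -/
def channel {V : Type*} {m : ℕ} (H : Matrix V (Fin m) ℝ) (k : Fin m) : EuclideanSpace ℝ V :=
  WithLp.toLp 2 (fun v => H v k)

/-- Random initialization of the weights of the layers `1, …, L` of a network with layer widths
`d`: all entries of all weight matrices are independent, and within layer `j + 1` every entry is
distributed like `ξ / √(layerWidth d₀ d j)`, where `ξ` has the law `ν j`. -/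
structure IsRandomInit {Ω : Type*} [MeasurableSpace Ω] (P : Measure Ω) (ν : ℕ → Measure ℝ)
    (L d₀ : ℕ) (d : ℕ → ℕ)
    (W : (l : ℕ) → Ω → Matrix (Fin (layerWidth d₀ d l)) (Fin (layerWidth d₀ d (l + 1))) ℝ) :
    Prop where
  indep : iIndepFun
    (fun (p : Σ l : Fin L, Fin (layerWidth d₀ d l) × Fin (layerWidth d₀ d (l + 1))) (ω : Ω) =>
      W p.1 ω p.2.1 p.2.2) P
  law : ∀ l < L, ∀ i j, HasLaw (fun ω => √(layerWidth d₀ d l : ℝ) * W l ω i j) (ν l) P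

/-- The widths whose first `r` values are `e` and whose remaining values are those of `t`. -/
def splitWidths {r : ℕ} (e : Fin r → ℕ) (t : ℕ → ℕ) (j : ℕ) : ℕ :=
  if h : j < r then e ⟨j, h⟩ else t j

theorem layerWidth_splitWidths (d₀ : ℕ) {r : ℕ} (e : Fin r → ℕ) (t : ℕ → ℕ) :
    t r = layerWidth d₀ (splitWidths e t) (r + 1) := by
  simp [layerWidth, splitWidths]

/-- Sequential (iterated) limit: `F (e₁, …, e_r)` tends to `a` as first `e₁ → ∞` (for all fixed
values of the others), then `e₂ → ∞`, and so on up to `e_r → ∞`. -/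
def SeqTendsto {α : Type*} [TopologicalSpace α] :
    (r : ℕ) → ((Fin r → ℕ) → α) → α → Prop
  | 0, F, a => F Fin.elim0 = a
  | r + 1, F, a => ∃ F' : (Fin r → ℕ) → α,
      (∀ e, Tendsto (fun N : ℕ => F (Fin.cons N e)) atTop (𝓝 (F' e))) ∧ SeqTendsto r F' a

/-- Convergence in distribution of the random variables `Z (e₁, …, e_r)` to the law `μ` as
`e₁, …, e_r` go to infinity one after another: the laws have `μ` as sequential limit in the
topology of weak convergence. -/
def SeqTendstoInDistribution {E : Type*} [TopologicalSpace E] [MeasurableSpace E]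
    [OpensMeasurableSpace E] (r : ℕ) {Ω : (Fin r → ℕ) → Type*} [∀ e, MeasurableSpace (Ω e)]
    (P : (e : Fin r → ℕ) → Measure (Ω e)) (Z : (e : Fin r → ℕ) → Ω e → E)
    (μ : ProbabilityMeasure E) : Prop :=
  ∃ Q : (Fin r → ℕ) → ProbabilityMeasure E,
    (∀ e, HasLaw (Z e) (Q e : Measure E) (P e)) ∧ SeqTendsto r Q μ

/-- The law of `m` independent random vectors with distribution `N(0, S)`. -/
def iidGaussian {V : Type*} [Fintype V] [DecidableEq V] (m : ℕ) (S : Matrix V V ℝ) :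
    ProbabilityMeasure (Fin m → EuclideanSpace ℝ V) :=
  ⟨Measure.pi (fun _ => multivariateGaussian 0 S), inferInstance⟩

/-- The matrix `E[σ(h) σ(h)ᵀ]` for a random vector `h` with law `μ`. -/
def postMoment {V : Type*} [Fintype V] (σ : ℝ → ℝ) (μ : Measure (EuclideanSpace ℝ V)) :
    Matrix V V ℝ :=
  Matrix.of (fun i j => ∫ h, σ (h i) * σ (h j) ∂μ)

/-- `G(S) = E[σ(h) σ(h)ᵀ]` for `h ∼ N(0, S)`. -/
def nngpG {V : Type*} [Fintype V] [DecidableEq V] (σ : ℝ → ℝ) (S : Matrix V V ℝ) :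
    Matrix V V ℝ :=
  postMoment σ (multivariateGaussian 0 S)

/-- `(σ_w² / d₀) A X Xᵀ A`. -/
def firstCov {V : Type*} [Fintype V] {d₀ : ℕ} (A : Matrix V V ℝ) (X : Matrix V (Fin d₀) ℝ)
    (σw : ℝ) : Matrix V V ℝ :=
  (σw ^ 2 / d₀) • (A * X * Xᵀ * A)

/-- The covariance recursion `Σ⁽¹⁾ = (σ_w² / d₀) A X Xᵀ A`, `Σ⁽ˡ⁺¹⁾ = σ_w² A G(Σ⁽ˡ⁾) A`; here
`nngpCov … l` is `Σ⁽ˡ⁺¹⁾`. -/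
def nngpCov {V : Type*} [Fintype V] [DecidableEq V] {d₀ : ℕ} (A : Matrix V V ℝ)
    (X : Matrix V (Fin d₀) ℝ) (σ : ℝ → ℝ) (σw : ℝ) : ℕ → Matrix V V ℝ
  | 0 => firstCov A X σw
  | l + 1 => σw ^ 2 • (A * nngpG σ (nngpCov A X σ σw l) * A)

/-- The law of the random vector `A X ξ / √d₀`, where `ξ` has `d₀` independent coordinates of
law `ν₁`. -/
def firstChannelLaw {V : Type*} [Fintype V] {d₀ : ℕ} (A : Matrix V V ℝ)
    (X : Matrix V (Fin d₀) ℝ) (ν₁ : Measure ℝ) : Measure (EuclideanSpace ℝ V) :=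
  (Measure.pi (fun _ : Fin d₀ => ν₁)).map
    (fun ξ => WithLp.toLp 2 ((√(d₀ : ℝ))⁻¹ • ((A * X) *ᵥ ξ)))

/-- The covariance recursion for a first layer whose weights need not be Gaussian: the step from
layer `1` to layer `2` uses the actual law of a channel of layer `1`, and all later steps
are `S ↦ σ_w² A G(S) A`. As above, `nngpCovOfLaw … l` belongs to layer `l + 1`. -/
def nngpCovOfLaw {V : Type*} [Fintype V] [DecidableEq V] {d₀ : ℕ} (A : Matrix V V ℝ)
    (X : Matrix V (Fin d₀) ℝ) (σ : ℝ → ℝ) (σw : ℝ) (ν₁ : Measure ℝ) : ℕ → Matrix V V ℝ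
  | 0 => firstCov A X σw
  | 1 => σw ^ 2 • (A * postMoment σ (firstChannelLaw A X ν₁) * A)
  | l + 2 => σw ^ 2 • (A * nngpG σ (nngpCovOfLaw A X σ σw ν₁ (l + 1)) * A)

end

/-! Every limit is a central limit theorem for one layer whose input channels are exactly i.i.d.
Paired with test vectors, the output channels of such a layer are `1 / √n` times a sum of `n` i.i.d.
centered variables of finite variance, so their joint law tends to a Gaussian
(`tendsto_convStep_pi`). Weights into different output channels are uncorrelated, so the limiting
covariance is block diagonal and the channels become independent.

The sequential order keeps the input channels exactly i.i.d. The first layer has independent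
channels at every width; once its width has gone to infinity, the second layer has independent
Gaussian channels at every width, and the argument restarts with one layer fewer
(`seqTendsto_netLaw`). The later layers, of fixed widths, act on laws by weakly continuous maps
(`continuous_convStep`), so the limit passes through them. Square integrability of `σ` is an
assumption on the first channel law only; afterwards the laws are Gaussian.

`IsRandomInit.hasLaw_gcnPreact` identifies the network with this composition of maps on laws. For
Gaussian first weights the first channel law is itself Gaussian, so part 1 is a case of part 2. -/

/-! ### Moments of linear forms in independent weights -/

/-- Second moments of independent centered variables of common law. -/
theorem integral_eval_mul_eval_pi {ι : Type*} [Fintype ι] [DecidableEq ι] {ν : Measure ℝ}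
    [IsProbabilityMeasure ν] (hmean : ∫ x, x ∂ν = 0) (i j : ι) :
    ∫ ξ : ι → ℝ, ξ i * ξ j ∂(Measure.pi fun _ => ν) = if i = j then variance id ν else 0 := by
  split_ifs with h
  · subst h
    have h1 := integral_comp_eval (μ := fun _ : ι => ν) (i := i) (f := fun x : ℝ => x * x)
      (by fun_prop)
    rw [h1, variance_of_integral_eq_zero aemeasurable_id (by simpa using hmean)]
    simp [pow_two]
  · have h1 : IndepFun (fun ξ : ι → ℝ => ξ i) (fun ξ => ξ j) (Measure.pi fun _ => ν) :=
      (iIndepFun_pi (μ := fun _ : ι => ν) (X := fun _ x => x)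
        (fun _ => measurable_id.aemeasurable)).indepFun h
    rw [h1.integral_fun_mul_eq_mul_integral
        (measurable_pi_apply i).aestronglyMeasurable (measurable_pi_apply j).aestronglyMeasurable,
      integral_eval (μ := fun _ : ι => ν), hmean, zero_mul]

theorem memLp_eval_pi {ι : Type*} [Fintype ι] {ν : Measure ℝ} [IsProbabilityMeasure ν]
    (hν : MemLp id 2 ν) (i : ι) :
    MemLp (fun ξ : ι → ℝ => ξ i) 2 (Measure.pi fun _ => ν) :=
  hν.comp_measurePreserving (measurePreserving_eval (fun _ : ι => ν) i)

section RandomLinearForm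

variable {ι S : Type*} [Fintype ι] [MeasurableSpace S] {μ : Measure S}
  {ν : Measure ℝ} [IsProbabilityMeasure ν] {g : ι → S → ℝ}

/-- The two factors depend on different coordinates of a product measure, so second moments of each
suffice and no fourth moments are needed. -/
theorem memLp_eval_mul_prod_pi (hν : MemLp id 2 ν) (hg : ∀ k, MemLp (g k) 2 μ) (k : ι) :
    MemLp (fun p : S × (ι → ℝ) => g k p.1 * p.2 k) 2 (μ.prod (Measure.pi fun _ => ν)) := by
  have h1 := hg k
  have h2 := memLp_eval_pi (ι := ι) hν k
  refine (memLp_two_iff_integrable_sq (h1.1.comp_fst.mul h2.1.comp_snd)).2 ?_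
  simp only [Pi.mul_apply, mul_pow]
  exact (h1.integrable_sq).mul_prod h2.integrable_sq

theorem memLp_sum_eval_mul_prod_pi (hν : MemLp id 2 ν) (hg : ∀ k, MemLp (g k) 2 μ) :
    MemLp (fun p : S × (ι → ℝ) => ∑ k, g k p.1 * p.2 k) 2 (μ.prod (Measure.pi fun _ => ν)) :=
  memLp_finsetSum _ fun k _ => memLp_eval_mul_prod_pi hν hg k

variable [IsProbabilityMeasure μ]

theorem integral_sum_eval_mul_prod_pi (hν : MemLp id 2 ν) (hmean : ∫ x, x ∂ν = 0)
    (hg : ∀ k, MemLp (g k) 2 μ) :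
    ∫ p : S × (ι → ℝ), ∑ k, g k p.1 * p.2 k ∂(μ.prod (Measure.pi fun _ => ν)) = 0 := by
  rw [integral_finsetSum _ fun k _ => (memLp_eval_mul_prod_pi hν hg k).integrable one_le_two]
  refine Finset.sum_eq_zero fun k _ => ?_
  rw [integral_prod_mul (g k) fun ξ : ι → ℝ => ξ k, integral_eval (μ := fun _ : ι => ν), hmean,
    mul_zero]

/-- The cross terms vanish because the weights are centered and independent, even though the `g k`
are dependent. With `k` an output channel, this additivity is what makes the limiting channels
independent. -/
theorem integral_sq_sum_eval_mul_prod_pi (hν : MemLp id 2 ν) (hmean : ∫ x, x ∂ν = 0)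
    (hg : ∀ k, MemLp (g k) 2 μ) :
    ∫ p : S × (ι → ℝ), (∑ k, g k p.1 * p.2 k) ^ 2 ∂(μ.prod (Measure.pi fun _ => ν)) =
      variance id ν * ∑ k, ∫ h, g k h ^ 2 ∂μ := by
  classical
  simp_rw [pow_two, Finset.sum_mul_sum]
  have hI k l : Integrable (fun p : S × (ι → ℝ) => g k p.1 * p.2 k * (g l p.1 * p.2 l))
      (μ.prod (Measure.pi fun _ => ν)) :=
    (memLp_eval_mul_prod_pi hν hg k).integrable_mul (memLp_eval_mul_prod_pi hν hg l)
  rw [integral_finsetSum _ fun k _ => integrable_finsetSum _ fun l _ => hI k l, Finset.mul_sum]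
  refine Finset.sum_congr rfl fun k _ => ?_
  rw [integral_finsetSum _ fun l _ => hI k l]
  have h1 l : ∫ p : S × (ι → ℝ), g k p.1 * p.2 k * (g l p.1 * p.2 l)
      ∂(μ.prod (Measure.pi fun _ => ν)) =
      (∫ h, g k h * g l h ∂μ) * if k = l then variance id ν else 0 := by
    rw [← integral_eval_mul_eval_pi hmean,
      ← integral_prod_mul (fun h => g k h * g l h) fun ξ : ι → ℝ => ξ k * ξ l]
    congr 1 with p
    ring
  simp_rw [h1]
  simp [mul_comm]

end RandomLinearForm

/-! ### Central limit theorem without normalized variance -/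

/-- The characteristic functions of normalized sums of independent copies of a centered square
integrable variable converge to that of the Gaussian law of the same variance. -/
theorem tendsto_charFun_inv_sqrt_pow {Ω : Type*} [MeasurableSpace Ω] {P : Measure Ω}
    [IsProbabilityMeasure P] {X : Ω → ℝ} (hX : MemLp X 2 P) (h0 : P[X] = 0) :
    Tendsto (fun n : ℕ => charFun (P.map X) (√n)⁻¹ ^ n) atTop
      (𝓝 (Complex.exp (-((∫ ω, X ω ^ 2 ∂P : ℝ) : ℂ) / 2))) := by
  have hXm := hX.1.aemeasurable
  set q := ∫ ω, X ω ^ 2 ∂P with hq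
  have hq0 : 0 ≤ q := integral_nonneg fun ω => sq_nonneg _
  -- A degenerate variable cannot be standardized; it vanishes almost surely.
  obtain h | h := hq0.eq_or_lt
  · have hX0 : X =ᵐ[P] fun _ => 0 := by
      have h2 := (integral_eq_zero_iff_of_nonneg (fun ω => sq_nonneg (X ω))
        hX.integrable_sq).1 (hq.symm.trans h.symm)
      filter_upwards [h2] with ω hω
      simpa using hω
    rw [Measure.map_congr hX0, ← h]
    simp
  · have hs : √q ≠ 0 := (Real.sqrt_pos.2 h).ne'
    -- The standardized variable `X / √q` is tested at `√q`, which gives back the characteristic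
    -- function of `X` at `1 / √n`.
    have h2 := tendsto_charFun_inv_sqrt_mul_pow (X := fun ω => (√q)⁻¹ * X ω) (P := P)
      (hXm.const_mul _) (by rw [integral_const_mul, h0, mul_zero])
      (by
        simp only [Pi.pow_apply, mul_pow]
        rw [integral_const_mul, ← hq, inv_pow, Real.sq_sqrt hq0, inv_mul_cancel₀ h.ne']) √q
    have h3 (n : ℕ) : charFun (P.map fun ω => (√q)⁻¹ * X ω) ((√n)⁻¹ * √q) =
        charFun (P.map X) (√n)⁻¹ := by
      rw [charFun_map_mul_comp hXm]
      congr 1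
      field_simp
    simp_rw [h3] at h2
    rw [← Complex.ofReal_pow, Real.sq_sqrt hq0] at h2
    exact h2

/-! ### One random layer as a map on laws, and its wide limit -/

section Layer

variable {V : Type*} [Fintype V]

/-- One graph convolution layer, applied to the post-activations of `n` input channels `p.1` with
the unnormalized weights `p.2`, as a map to the `m` output channels. -/
noncomputable def convMap (A : Matrix V V ℝ) (σ : ℝ → ℝ) (n m : ℕ)
    (p : (Fin n → EuclideanSpace ℝ V) × (Fin n → Fin m → ℝ)) : Fin m → EuclideanSpace ℝ V :=
  fun k => WithLp.toLp 2 fun v => ∑ j, (∑ u, A v u * σ (p.1 j u)) * ((√(n : ℝ))⁻¹ * p.2 j k)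

variable {A : Matrix V V ℝ} {σ : ℝ → ℝ}

theorem continuous_convMap (hσ : Continuous σ) (n m : ℕ) : Continuous (convMap A σ n m) := by
  unfold convMap
  fun_prop

variable (A) in
/-- The law of the output channels of a random layer with weight law `ν`, from the law `Q` of the
input channels. -/
noncomputable def convStep (hσ : Continuous σ) (ν : ProbabilityMeasure ℝ) (n m : ℕ)
    (Q : ProbabilityMeasure (Fin n → EuclideanSpace ℝ V)) :
    ProbabilityMeasure (Fin m → EuclideanSpace ℝ V) :=
  (Q.prod (.pi fun _ => .pi fun _ => ν)).map
    (continuous_convMap (A := A) hσ n m).measurable.aemeasurable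

/-- Products and push-forwards along continuous maps are weakly continuous, so no moment condition
is needed. This carries a limit in an earlier width through a later layer. -/
theorem continuous_convStep (hσ : Continuous σ) (ν : ProbabilityMeasure ℝ) (n m : ℕ) :
    Continuous (convStep A hσ ν n m) := by
  unfold convStep
  refine (ProbabilityMeasure.continuous_map (continuous_convMap hσ n m)).comp ?_
  exact ProbabilityMeasure.continuous_prod.comp (continuous_id.prodMk continuous_const)

/-- The pairing of a convolved post-activation vector with a test vector. -/
def convPairing (A : Matrix V V ℝ) (σ : ℝ → ℝ) (t : EuclideanSpace ℝ V)
    (h : EuclideanSpace ℝ V) : ℝ :=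
  ∑ v, (∑ u, A v u * σ (h u)) * t v

theorem memLp_convPairing {μ : Measure (EuclideanSpace ℝ V)}
    (hμ : ∀ v, MemLp (fun h : EuclideanSpace ℝ V => σ (h v)) 2 μ) (t : EuclideanSpace ℝ V) :
    MemLp (convPairing A σ t) 2 μ := by
  unfold convPairing
  exact memLp_finsetSum _ fun v _ =>
    (memLp_finsetSum _ fun u _ => (hμ u).const_mul (A v u)).mul_const (t v)

/-- Input channel `j` enters the outputs only together with its own row of weights, and these pairs
are i.i.d. over `j`; the characteristic function of their sum is a power. -/
theorem charFun_convStep_pi (hσ : Continuous σ) (ν : ProbabilityMeasure ℝ)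
    (μ : ProbabilityMeasure (EuclideanSpace ℝ V)) (n m : ℕ)
    (t : PiLp 2 fun _ : Fin m => EuclideanSpace ℝ V) :
    charFun ((convStep A hσ ν n m (.pi fun _ => μ) : Measure _).map (WithLp.toLp 2)) t =
      charFun (((μ : Measure _).prod (Measure.pi fun _ : Fin m => (ν : Measure ℝ))).map
        fun p => ∑ k, convPairing A σ (t k) p.1 * p.2 k) (√(n : ℝ))⁻¹ ^ n := by
  have hc := continuous_convMap (A := A) hσ n m
  have hX : Measurable fun p : EuclideanSpace ℝ V × (Fin m → ℝ) =>
      ∑ k, convPairing A σ (t k) p.1 * p.2 k := by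
    unfold convPairing
    fun_prop
  have hpair (x : Fin n → EuclideanSpace ℝ V × (Fin m → ℝ)) :
      inner ℝ (WithLp.toLp 2 (convMap A σ n m
        (MeasurableEquiv.arrowProdEquivProdArrow _ _ _ x))) t =
      ∑ j, (√(n : ℝ))⁻¹ * ∑ k, convPairing A σ (t k) (x j).1 * (x j).2 k := by
    simp only [PiLp.inner_apply, convMap, convPairing, RCLike.inner_apply, conj_trivial,
      Finset.mul_sum, Finset.sum_mul]
    conv_lhs => enter [2, k]; rw [Finset.sum_comm]
    rw [Finset.sum_comm]
    refine Finset.sum_congr rfl fun j _ => Finset.sum_congr rfl fun k _ =>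
      Finset.sum_congr rfl fun v _ => Finset.sum_congr rfl fun u _ => ?_
    rw [MeasurableEquiv.arrowProdEquivProdArrow]
    simp [Equiv.arrowProdEquivProdArrow]
    ring
  rw [charFun_apply, charFun_apply_real,
    integral_map (by fun_prop) (by fun_prop), integral_map hX.aemeasurable (by fun_prop)]
  simp only [convStep, ProbabilityMeasure.toMeasure_map, ProbabilityMeasure.toMeasure_prod,
    ProbabilityMeasure.toMeasure_pi]
  -- Regrouping channels and weight rows into pairs turns the measure into a product over `j`, over
  -- which the exponential factors.
  rw [integral_map hc.measurable.aemeasurable (by fun_prop),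
    ← (measurePreserving_arrowProdEquivProdArrow (EuclideanSpace ℝ V) (Fin m → ℝ) (Fin n)
      (fun _ => (μ : Measure _)) fun _ => Measure.pi fun _ => (ν : Measure ℝ)).integral_comp']
  simp_rw [hpair, Complex.ofReal_sum, Finset.sum_mul, Complex.exp_sum]
  rw [integral_fintype_prod_eq_prod (f := fun (_ : Fin n) (y : EuclideanSpace ℝ V × (Fin m → ℝ)) =>
    Complex.exp (((√(n : ℝ))⁻¹ * ∑ k, convPairing A σ (t k) y.1 * y.2 k : ℝ) * Complex.I))]
  simp

/-- The covariance matrix of an output channel of a wide random layer whose input channels are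
independent with law `μ`. -/
noncomputable def convCov (A : Matrix V V ℝ) (σ : ℝ → ℝ) (σw : ℝ)
    (μ : Measure (EuclideanSpace ℝ V)) : Matrix V V ℝ :=
  σw ^ 2 • (A * postMoment σ μ * A)

/-- Symmetry moves both copies of `A` onto `t`, leaving the second moment of a linear form in
`σ(h)`. This yields both positive semi-definiteness and the exponent of the limiting characteristic
function. -/
theorem dotProduct_convCov_mulVec {μ : Measure (EuclideanSpace ℝ V)}
    (hμ : ∀ v, MemLp (fun h : EuclideanSpace ℝ V => σ (h v)) 2 μ) (hA : A.IsSymm) (σw : ℝ)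
    (t : EuclideanSpace ℝ V) :
    t ⬝ᵥ convCov A σ σw μ *ᵥ t = σw ^ 2 * ∫ h, convPairing A σ t h ^ 2 ∂μ := by
  have h1 (h : EuclideanSpace ℝ V) :
      convPairing A σ t h = ∑ u, (A *ᵥ t) u * σ (h u) := by
    simp only [convPairing, Finset.sum_mul, mulVec, dotProduct]
    rw [Finset.sum_comm]
    refine Finset.sum_congr rfl fun u _ => Finset.sum_congr rfl fun v _ => ?_
    rw [hA.apply u v]
    ring
  have hI u w : Integrable (fun h : EuclideanSpace ℝ V =>
      (A *ᵥ t) u * σ (h u) * ((A *ᵥ t) w * σ (h w))) μ :=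
    ((hμ u).const_mul _).integrable_mul ((hμ w).const_mul _)
  have h2 : ∫ h, convPairing A σ t h ^ 2 ∂μ = (A *ᵥ t) ⬝ᵥ postMoment σ μ *ᵥ (A *ᵥ t) := by
    simp_rw [h1, pow_two, Finset.sum_mul_sum]
    generalize A *ᵥ t.ofLp = c at hI ⊢
    rw [integral_finsetSum _ fun u _ => integrable_finsetSum _ fun w _ => hI u w]
    refine Finset.sum_congr rfl fun u _ => ?_
    rw [integral_finsetSum _ fun w _ => hI u w, mulVec, dotProduct, Finset.mul_sum]
    refine Finset.sum_congr rfl fun w _ => ?_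
    rw [postMoment, of_apply, ← integral_mul_const, ← integral_const_mul]
    congr 1 with h
    ring
  rw [h2, convCov, smul_mulVec, dotProduct_smul, ← mulVec_mulVec, ← mulVec_mulVec,
    dotProduct_mulVec t.ofLp A, ← mulVec_transpose, hA.eq, smul_eq_mul]

theorem isSymm_postMoment (μ : Measure (EuclideanSpace ℝ V)) : (postMoment σ μ).IsSymm := by
  ext i j
  simp [postMoment, mul_comm]

theorem posSemidef_convCov {μ : Measure (EuclideanSpace ℝ V)}
    (hμ : ∀ v, MemLp (fun h : EuclideanSpace ℝ V => σ (h v)) 2 μ) (hA : A.IsSymm) (σw : ℝ) :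
    (convCov A σ σw μ).PosSemidef := by
  refine .of_dotProduct_mulVec_nonneg ?_ fun x => ?_
  · rw [IsHermitian, conjTranspose_eq_transpose_of_trivial, convCov, transpose_smul,
      transpose_mul, transpose_mul, hA.eq, (isSymm_postMoment μ).eq, Matrix.mul_assoc]
  · have := dotProduct_convCov_mulVec hμ hA σw (WithLp.toLp 2 x)
    simp only [star_trivial] at this ⊢
    rw [this]
    exact mul_nonneg (sq_nonneg _) (integral_nonneg fun _ => sq_nonneg _)

theorem memLp_comp_eval_multivariateGaussian [DecidableEq V]
    (hG : ∀ v : NNReal, MemLp σ 2 (gaussianReal 0 v)) {S : Matrix V V ℝ} (hS : S.PosSemidef)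
    (v : V) : MemLp (fun h : EuclideanSpace ℝ V => σ (h v)) 2 (multivariateGaussian 0 S) :=
  (hG _).comp_measurePreserving (measurePreserving_eval_multivariateGaussian hS)

variable [DecidableEq V]

/-- The limiting law of an output channel of a wide random layer whose input channels are
independent with law `μ`. -/
noncomputable def convLimit (A : Matrix V V ℝ) (σ : ℝ → ℝ) (σw : ℝ)
    (μ : ProbabilityMeasure (EuclideanSpace ℝ V)) : ProbabilityMeasure (EuclideanSpace ℝ V) :=
  ⟨multivariateGaussian 0 (convCov A σ σw μ), inferInstance⟩

theorem tendsto_convStep_pi (hσ : Continuous σ) (ν : ProbabilityMeasure ℝ)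
    (μ : ProbabilityMeasure (EuclideanSpace ℝ V)) (hA : A.IsSymm) {σw : ℝ}
    (hμ : ∀ v, MemLp (fun h : EuclideanSpace ℝ V => σ (h v)) 2 (μ : Measure _))
    (hν : MemLp id 2 (ν : Measure ℝ)) (hmean : ∫ x, x ∂(ν : Measure ℝ) = 0)
    (hvar : variance id (ν : Measure ℝ) = σw ^ 2) (m : ℕ) :
    Tendsto (fun N => convStep A hσ ν N m (.pi fun _ => μ)) atTop
      (𝓝 (.pi fun _ => convLimit A σ σw μ)) := by
  -- Characteristic functions need an inner product, which the plain function space lacks; the laws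
  -- are moved to the `ℓ²` product and back.
  set F := PiLp 2 fun _ : Fin m => EuclideanSpace ℝ V
  have hto : Measurable (WithLp.toLp 2 : (Fin m → EuclideanSpace ℝ V) → F) := by fun_prop
  have hof : Continuous (WithLp.ofLp : F → (Fin m → EuclideanSpace ℝ V)) := by fun_prop
  have hback (Q : ProbabilityMeasure (Fin m → EuclideanSpace ℝ V)) :
      (Q.map hto.aemeasurable).map hof.measurable.aemeasurable = Q := by
    apply Subtype.ext
    simp only [ProbabilityMeasure.val_eq_to_measure, ProbabilityMeasure.toMeasure_map]
    rw [Measure.map_map hof.measurable hto]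
    exact Measure.map_id
  suffices H : Tendsto
      (fun N => (convStep A hσ ν N m (.pi fun _ => μ)).map hto.aemeasurable) atTop
      (𝓝 ((ProbabilityMeasure.pi fun _ => convLimit A σ σw μ).map hto.aemeasurable)) by
    have := ((ProbabilityMeasure.continuous_map hof).tendsto _).comp H
    simpa only [Function.comp_def, hback] using this
  rw [ProbabilityMeasure.tendsto_iff_tendsto_charFun]
  intro t
  have hg k : MemLp (convPairing A σ (t k)) 2 (μ : Measure _) := memLp_convPairing hμ _
  have h1 := tendsto_charFun_inv_sqrt_pow (memLp_sum_eval_mul_prod_pi hν hg)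
    (integral_sum_eval_mul_prod_pi hν hmean hg)
  rw [integral_sq_sum_eval_mul_prod_pi hν hmean hg, hvar, Finset.mul_sum] at h1
  simp only [ProbabilityMeasure.toMeasure_map, charFun_convStep_pi,
    ProbabilityMeasure.toMeasure_pi]
  -- Independence of the limiting channels factors the characteristic function over `k`, matching
  -- the sum over `k` in the variance.
  rw [charFun_pi]
  convert h1 using 2
  simp only [convLimit, ProbabilityMeasure.coe_mk,
    charFun_multivariateGaussian (posSemidef_convCov hμ hA σw), dotProduct_convCov_mulVec hμ hA σw]
  rw [← Complex.exp_sum]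
  simp [Finset.sum_div, neg_div]

end Layer

/-! ### Composition of layers and sequential limits -/

section Network

variable {V : Type*} [Fintype V] {A : Matrix V V ℝ} {σ : ℝ → ℝ}

variable (A) in
/-- The law of the `m` channels obtained by applying `r` hidden random layers of input widths
`e 0, …, e (r - 1)` with weight laws `ν 0, …, ν (r - 1)` to channels of law `init`. -/
noncomputable def netLaw (hσ : Continuous σ) : (r : ℕ) → (ν : ℕ → ProbabilityMeasure ℝ) →
    (e : Fin r → ℕ) → (init : (n : ℕ) → ProbabilityMeasure (Fin n → EuclideanSpace ℝ V)) →
    (m : ℕ) → ProbabilityMeasure (Fin m → EuclideanSpace ℝ V)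
  | 0, _, _, init, m => init m
  | r + 1, ν, e, init, m =>
    netLaw hσ r (fun j => ν (j + 1)) (fun j => e j.succ)
      (fun m' => convStep A hσ (ν 0) (e 0) m' (init (e 0))) m

/-- `netLaw` peels off the first layer, as the sequential limit does, whereas the network recursion
adds a last layer; this reconciles the two. -/
theorem netLaw_succ_last (hσ : Continuous σ) (r : ℕ) (ν : ℕ → ProbabilityMeasure ℝ) (d : ℕ → ℕ)
    (init : (n : ℕ) → ProbabilityMeasure (Fin n → EuclideanSpace ℝ V)) (m : ℕ) :
    netLaw A hσ (r + 1) ν (fun j => d j) init m =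
      convStep A hσ (ν r) (d r) m (netLaw A hσ r ν (fun j => d j) init (d r)) := by
  induction r generalizing ν d init with
  | zero => rfl
  | succ r ih =>
    exact ih (fun j => ν (j + 1)) (fun j => d (j + 1))
      fun m' => convStep A hσ (ν 0) (d 0) m' (init (d 0))

theorem tendsto_netLaw {α : Type*} {F : Filter α} (hσ : Continuous σ) (r : ℕ)
    (ν : ℕ → ProbabilityMeasure ℝ) (e : Fin r → ℕ)
    {init : α → (n : ℕ) → ProbabilityMeasure (Fin n → EuclideanSpace ℝ V)}
    {init₀ : (n : ℕ) → ProbabilityMeasure (Fin n → EuclideanSpace ℝ V)}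
    (h : ∀ n, Tendsto (fun a => init a n) F (𝓝 (init₀ n))) (m : ℕ) :
    Tendsto (fun a => netLaw A hσ r ν e (init a) m) F (𝓝 (netLaw A hσ r ν e init₀ m)) := by
  induction r generalizing ν init init₀ with
  | zero => exact h m
  | succ r ih =>
    exact ih _ _ fun n => ((continuous_convStep hσ (ν 0) (e 0) n).tendsto _).comp (h (e 0))

/-- Induction with `μ` and `ν` general: sending the first width to infinity replaces `μ` by
`convLimit A σ σw μ`, again an i.i.d. input at every width, now Gaussian and hence square integrable
after `σ`. -/
theorem seqTendsto_netLaw [DecidableEq V] (hσ : Continuous σ)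
    (hG : ∀ v : NNReal, MemLp σ 2 (gaussianReal 0 v)) (hA : A.IsSymm) {σw : ℝ} (m r : ℕ)
    (ν : ℕ → ProbabilityMeasure ℝ)
    (hν : ∀ l, MemLp id 2 (ν l : Measure ℝ)) (hmean : ∀ l, ∫ x, x ∂(ν l : Measure ℝ) = 0)
    (hvar : ∀ l, variance id (ν l : Measure ℝ) = σw ^ 2)
    (μ : ProbabilityMeasure (EuclideanSpace ℝ V))
    (hμ : ∀ v, MemLp (fun h : EuclideanSpace ℝ V => σ (h v)) 2 (μ : Measure _)) :
    SeqTendsto r (fun e => netLaw A hσ r ν e (fun _ => .pi fun _ => μ) m)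
      (.pi fun _ => (convLimit A σ σw)^[r] μ) := by
  induction r generalizing ν μ with
  | zero => rfl
  | succ r ih =>
    refine ⟨fun e => netLaw A hσ r (fun j => ν (j + 1)) e
      (fun _ => .pi fun _ => convLimit A σ σw μ) m, fun e => ?_, ?_⟩
    · exact tendsto_netLaw hσ r _ e
        (fun n => tendsto_convStep_pi hσ (ν 0) μ hA hμ (hν 0) (hmean 0) (hvar 0) n) m
    · rw [Function.iterate_succ_apply]
      exact ih _ (fun l => hν (l + 1)) (fun l => hmean (l + 1)) (fun l => hvar (l + 1)) _
        fun v => memLp_comp_eval_multivariateGaussian hG (posSemidef_convCov hμ hA σw) v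

theorem memLp_comp_eval_iterate_convLimit [DecidableEq V]
    (hG : ∀ v : NNReal, MemLp σ 2 (gaussianReal 0 v)) (hA : A.IsSymm) {σw : ℝ}
    {μ : ProbabilityMeasure (EuclideanSpace ℝ V)}
    (hμ : ∀ v, MemLp (fun h : EuclideanSpace ℝ V => σ (h v)) 2 (μ : Measure _)) (r : ℕ) :
    ∀ v, MemLp (fun h : EuclideanSpace ℝ V => σ (h v)) 2
      ((convLimit A σ σw)^[r] μ : ProbabilityMeasure _).toMeasure := by
  induction r with
  | zero => exact hμ
  | succ r ih =>
    rw [Function.iterate_succ_apply']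
    exact memLp_comp_eval_multivariateGaussian hG (posSemidef_convCov ih hA σw)

/-- A family of independent variables of common law, indexed by pairs, as a random matrix. -/
theorem hasLaw_pi_pi_of_iIndepFun {Ω α β : Type*} [MeasurableSpace Ω] {P : Measure Ω} [Fintype α]
    [Fintype β] {ν : Measure ℝ} [IsProbabilityMeasure ν] {Y : α → β → Ω → ℝ}
    (hY : ∀ a b, HasLaw (Y a b) ν P) (h : iIndepFun (fun p : α × β => Y p.1 p.2) P) :
    HasLaw (fun ω a b => Y a b ω) (Measure.pi fun _ => Measure.pi fun _ => ν) P := by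
  have h1 := h.hasLaw_pi (μ := fun _ => ν) fun p : α × β => hY p.1 p.2
  refine HasLaw.comp (Y := MeasurableEquiv.curry α β ℝ)
    ⟨(MeasurableEquiv.measurable _).aemeasurable, ?_⟩ h1
  have h2 := Measure.infinitePi_map_curry (fun (_ : α) (_ : β) => ν)
  simpa only [Measure.infinitePi_eq_pi] using h2

variable {d₀ : ℕ} {X : Matrix V (Fin d₀) ℝ} {d : ℕ → ℕ}

theorem gcnLayer_zero_bias_apply {n m : ℕ} (Y : Matrix V (Fin n) ℝ) (W : Matrix (Fin n) (Fin m) ℝ)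
    (v : V) (k : Fin m) :
    gcnLayer A Y W (fun _ => 0) v k = ∑ j, (A * Y) v j * W j k := by
  rw [gcnLayer, Matrix.add_apply, of_apply, add_zero, mul_apply]

theorem gcnPreact_zero_apply
    (W : (l : ℕ) → Matrix (Fin (layerWidth d₀ d l)) (Fin (layerWidth d₀ d (l + 1))) ℝ)
    (v : V) (k : Fin (layerWidth d₀ d 1)) :
    gcnPreact A X σ d W (fun _ _ => 0) 0 v k = ∑ j : Fin d₀, (A * X) v j * W 0 j k :=
  gcnLayer_zero_bias_apply X (W 0) v k

theorem gcnPreact_succ_apply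
    (W : (l : ℕ) → Matrix (Fin (layerWidth d₀ d l)) (Fin (layerWidth d₀ d (l + 1))) ℝ) (l : ℕ)
    (v : V) (k : Fin (layerWidth d₀ d (l + 2))) :
    gcnPreact A X σ d W (fun _ _ => 0) (l + 1) v k =
      ∑ j : Fin (d l), (∑ u, A v u * σ (gcnPreact A X σ d W (fun _ _ => 0) l u j)) *
        W (l + 1) j k :=
  gcnLayer_zero_bias_apply _ (W (l + 1)) v k

/-- The σ-algebra on `Ω` is arbitrary, so that it can later be the one generated by the weights of
the layers up to `l`. -/
theorem measurable_gcnPreact {Ω : Type*} [MeasurableSpace Ω] (hσ : Continuous σ)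
    {W : (l : ℕ) → Ω → Matrix (Fin (layerWidth d₀ d l)) (Fin (layerWidth d₀ d (l + 1))) ℝ} {l : ℕ}
    (hW : ∀ l' ≤ l, ∀ i j, Measurable fun ω => W l' ω i j) (v : V)
    (k : Fin (layerWidth d₀ d (l + 1))) :
    Measurable fun ω => gcnPreact A X σ d (fun l => W l ω) (fun _ _ => 0) l v k := by
  induction l generalizing v with
  | zero =>
    simp only [gcnPreact_zero_apply]
    exact Finset.measurable_sum _ fun j _ => (hW 0 le_rfl j k).const_mul _
  | succ l ih =>
    have ih' := ih fun l' hl => hW l' (hl.trans l.le_succ)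
    simp only [gcnPreact_succ_apply]
    exact Finset.measurable_sum _ fun j _ => (Finset.measurable_sum _ fun u _ =>
      (hσ.measurable.comp (ih' u j)).const_mul _).mul (hW (l + 1) le_rfl j k)

theorem gcnPreact_congr {W W' : (l : ℕ) →
      Matrix (Fin (layerWidth d₀ d l)) (Fin (layerWidth d₀ d (l + 1))) ℝ}
    {b : (l : ℕ) → Fin (layerWidth d₀ d (l + 1)) → ℝ} {l : ℕ} (h : ∀ l' ≤ l, W l' = W' l') :
    gcnPreact A X σ d W b l = gcnPreact A X σ d W' b l := by
  induction l with
  | zero => simp only [gcnPreact, h 0 le_rfl]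
  | succ l ih =>
    simp only [gcnPreact, h (l + 1) le_rfl, ih fun l' hl => h l' (hl.trans l.le_succ)]

theorem channel_gcnPreact_succ
    (W : (l : ℕ) → Matrix (Fin (layerWidth d₀ d l)) (Fin (layerWidth d₀ d (l + 1))) ℝ) (l : ℕ) :
    (fun k => channel (gcnPreact A X σ d W (fun _ _ => 0) (l + 1)) k) =
      convMap A σ (d l) (d (l + 1)) (channel (gcnPreact A X σ d W (fun _ _ => 0) l),
        fun i j => √(d l : ℝ) * W (l + 1) i j) := by
  funext k
  ext v
  refine (gcnPreact_succ_apply W l v k).trans ?_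
  refine Finset.sum_congr rfl fun j _ => ?_
  -- The width may be zero, but then the sum is empty; an index `j` makes it positive.
  have hj : √(d l : ℝ) ≠ 0 :=
    (Real.sqrt_pos.2 (Nat.cast_pos.2 (Fin.pos (n := d l) j))).ne'
  rw [inv_mul_cancel_left₀ hj]
  rfl

theorem channel_gcnPreact_zero
    (W : (l : ℕ) → Matrix (Fin (layerWidth d₀ d l)) (Fin (layerWidth d₀ d (l + 1))) ℝ)
    (k : Fin (layerWidth d₀ d 1)) :
    channel (gcnPreact A X σ d W (fun _ _ => 0) 0) k =
      WithLp.toLp 2 ((√(d₀ : ℝ))⁻¹ • ((A * X) *ᵥ fun j : Fin d₀ => √(d₀ : ℝ) * W 0 j k)) := by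
  ext v
  refine (gcnPreact_zero_apply (σ := σ) W v k).trans ?_
  simp only [Pi.smul_apply, mulVec, dotProduct, smul_eq_mul, Finset.mul_sum]
  refine Finset.sum_congr rfl fun j _ => ?_
  have hj : √(d₀ : ℝ) ≠ 0 :=
    (Real.sqrt_pos.2 (Nat.cast_pos.2 (Fin.pos (n := d₀) j))).ne'
  rw [mul_left_comm, inv_mul_cancel_left₀ hj]

theorem measurable_firstChannel {α : Type*} (B : Matrix α (Fin d₀) ℝ) (c : ℝ) :
    Measurable fun ξ : Fin d₀ → ℝ => WithLp.toLp 2 (c • (B *ᵥ ξ)) := by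
  unfold mulVec dotProduct
  fun_prop

instance isProbabilityMeasure_firstChannelLaw (ν₁ : Measure ℝ) [IsProbabilityMeasure ν₁] :
    IsProbabilityMeasure (firstChannelLaw A X ν₁) :=
  Measure.isProbabilityMeasure_map (measurable_firstChannel _ _).aemeasurable

/-! ### The law of the network at random initialization -/

section RandomInit

variable {Ω : Type*} [MeasurableSpace Ω] {P : Measure Ω} {ν : ℕ → Measure ℝ} {L : ℕ}
  {W : (l : ℕ) → Ω → Matrix (Fin (layerWidth d₀ d l)) (Fin (layerWidth d₀ d (l + 1))) ℝ}

theorem IsRandomInit.iIndepFun_layer (hW : IsRandomInit P ν L d₀ d W) {l : ℕ} (hl : l < L) :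
    iIndepFun (fun (p : Fin (layerWidth d₀ d l) × Fin (layerWidth d₀ d (l + 1))) ω =>
      √(layerWidth d₀ d l : ℝ) * W l ω p.1 p.2) P :=
  (hW.indep.precomp (g := fun p => ⟨⟨l, hl⟩, p⟩) fun _ _ h => by simpa using h).comp
    (fun _ x => √(layerWidth d₀ d l : ℝ) * x) fun _ => measurable_const_mul _

theorem IsRandomInit.aemeasurable (hW : IsRandomInit P ν L d₀ d W) {l : ℕ} (hl : l < L)
    (i : Fin (layerWidth d₀ d l)) (j : Fin (layerWidth d₀ d (l + 1))) :
    AEMeasurable (fun ω => W l ω i j) P := by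
  have hi : √(layerWidth d₀ d l : ℝ) ≠ 0 := (Real.sqrt_pos.2 (Nat.cast_pos.2 i.pos)).ne'
  have h := (hW.law l hl i j).aemeasurable.const_mul (√(layerWidth d₀ d l : ℝ))⁻¹
  simpa only [inv_mul_cancel_left₀ hi] using h

/-- Random initial weights agree almost surely with measurable ones. -/
theorem IsRandomInit.exists_measurable (hW : IsRandomInit P ν L d₀ d W) :
    ∃ W' : (l : ℕ) → Ω → Matrix (Fin (layerWidth d₀ d l)) (Fin (layerWidth d₀ d (l + 1))) ℝ,
      IsRandomInit P ν L d₀ d W' ∧ (∀ l < L, ∀ i j, Measurable fun ω => W' l ω i j) ∧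
      ∀ᵐ ω ∂P, ∀ l < L, W l ω = W' l ω := by
  let W' : (l : ℕ) → Ω → Matrix (Fin (layerWidth d₀ d l)) (Fin (layerWidth d₀ d (l + 1))) ℝ :=
    fun l ω => of fun i j => if hl : l < L then (hW.aemeasurable hl i j).mk _ ω else 0
  have hm : ∀ l < L, ∀ i j, Measurable fun ω => W' l ω i j := fun l hl i j => by
    simpa [W', hl] using (hW.aemeasurable hl i j).measurable_mk
  have hae : ∀ l < L, ∀ i j, (fun ω => W l ω i j) =ᵐ[P] fun ω => W' l ω i j := fun l hl i j => by
    simpa [W', hl] using (hW.aemeasurable hl i j).ae_eq_mk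
  refine ⟨W', ⟨hW.indep.congr fun p => hae _ p.1.2 _ _, fun l hl i j => ?_⟩, hm, ?_⟩
  · refine (hW.law l hl i j).congr ?_
    filter_upwards [hae l hl i j] with ω hω
    rw [hω]
  · rw [ae_all_iff]
    intro l
    by_cases hl : l < L
    · have : ∀ᵐ ω ∂P, ∀ i j, W l ω i j = W' l ω i j :=
        ae_all_iff.2 fun i => ae_all_iff.2 fun j => hae l hl i j
      filter_upwards [this] with ω hω _
      ext i j
      exact hω i j
    · exact .of_forall fun ω h => absurd h hl

/-- The channels of a layer are independent of the weights of the next layer. -/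
theorem IsRandomInit.indepFun_channel (hW : IsRandomInit P ν L d₀ d W) (hσ : Continuous σ)
    (hm : ∀ l < L, ∀ i j, Measurable fun ω => W l ω i j) {l : ℕ} (hl : l + 1 < L) :
    IndepFun (fun ω => channel (gcnPreact A X σ d (fun l => W l ω) (fun _ _ => 0) l))
      (fun ω i j => √(layerWidth d₀ d (l + 1) : ℝ) * W (l + 1) ω i j) P := by
  let ι := Σ l : Fin L, Fin (layerWidth d₀ d l) × Fin (layerWidth d₀ d (l + 1))
  let 𝓜 : ι → MeasurableSpace Ω := fun p =>
    MeasurableSpace.comap (fun ω => W p.1 ω p.2.1 p.2.2) inferInstance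
  -- Disjoint blocks of independent weights generate independent σ-algebras: layers up to `l`
  -- against layer `l + 1`.
  let S : Set ι := {p | (p.1 : ℕ) ≤ l}
  let T : Set ι := {p | (p.1 : ℕ) = l + 1}
  have hST : Disjoint S T := Set.disjoint_left.2 fun p (hp : (p.1 : ℕ) ≤ l) hp' => by
    have : (p.1 : ℕ) = l + 1 := hp'
    omega
  have hind : Indep (⨆ p ∈ S, 𝓜 p) (⨆ p ∈ T, 𝓜 p) P :=
    indep_iSup_of_disjoint (fun p => (hm _ p.1.2 _ _).comap_le) hW.indep.iIndep hST
  have hle (U : Set ι) (p : ι) (hp : p ∈ U) :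
      @Measurable _ _ (⨆ p ∈ U, 𝓜 p) _ fun ω => W p.1 ω p.2.1 p.2.2 :=
    (comap_measurable _).mono (le_iSup₂ (f := fun p _ => 𝓜 p) p hp) le_rfl
  refine indep_of_indep_of_le_left (indep_of_indep_of_le_right hind ?_) ?_
  · refine Measurable.comap_le ?_
    refine @measurable_pi_lambda _ _ _ (⨆ p ∈ T, 𝓜 p) _ _ fun i => ?_
    refine @measurable_pi_lambda _ _ _ (⨆ p ∈ T, 𝓜 p) _ _ fun j => ?_
    exact (measurable_const_mul _).comp (hle T ⟨⟨l + 1, hl⟩, i, j⟩ rfl)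
  · refine Measurable.comap_le ?_
    refine @measurable_pi_lambda _ _ _ (⨆ p ∈ S, 𝓜 p) _ _ fun k => ?_
    have hto : Measurable (WithLp.toLp 2 : (V → ℝ) → EuclideanSpace ℝ V) := by fun_prop
    refine @Measurable.comp _ _ _ (⨆ p ∈ S, 𝓜 p) _ _ _ _ hto ?_
    refine @measurable_pi_lambda _ _ _ (⨆ p ∈ S, 𝓜 p) _ _ fun v => ?_
    exact @measurable_gcnPreact _ _ _ _ _ _ _ _ (⨆ p ∈ S, 𝓜 p) hσ _ _
      (fun l' hl' i j => hle S ⟨⟨l', by omega⟩, i, j⟩ hl') v k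

variable [∀ l, IsProbabilityMeasure (ν l)]

theorem IsRandomInit.hasLaw_firstLayer (hW : IsRandomInit P ν L d₀ d W) (hL : 0 < L) :
    HasLaw (fun ω (k : Fin (layerWidth d₀ d 1)) =>
        channel (gcnPreact A X σ d (fun l => W l ω) (fun _ _ => 0) 0) k)
      (Measure.pi fun _ => firstChannelLaw A X (ν 0)) P := by
  have h1 := hasLaw_pi_pi_of_iIndepFun (ν := ν 0)
    (Y := fun k (j : Fin (layerWidth d₀ d 0)) ω => √(layerWidth d₀ d 0 : ℝ) * W 0 ω j k)
    (fun k j => hW.law 0 hL j k)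
    -- The swap lists weights by output channel first, so each channel is a function of its own
    -- independent weight vector.
    ((hW.iIndepFun_layer hL).precomp (g := Prod.swap) Prod.swap_injective)
  have hf := measurable_firstChannel (A * X) (√(d₀ : ℝ))⁻¹
  have h2 : HasLaw (fun (ξ : Fin (layerWidth d₀ d 1) → Fin d₀ → ℝ) k =>
      (WithLp.toLp 2 ((√(d₀ : ℝ))⁻¹ • ((A * X) *ᵥ ξ k)) : EuclideanSpace ℝ V))
      (Measure.pi fun _ => firstChannelLaw A X (ν 0))
      (Measure.pi fun _ => Measure.pi fun _ => ν 0) := by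
    have hpi (k : Fin (layerWidth d₀ d 1)) : SigmaFinite
        ((Measure.pi fun _ : Fin d₀ => ν 0).map fun ξ : Fin d₀ → ℝ =>
          (WithLp.toLp 2 ((√(d₀ : ℝ))⁻¹ • ((A * X) *ᵥ ξ)) : EuclideanSpace ℝ V)) :=
      have := Measure.isProbabilityMeasure_map (μ := Measure.pi fun _ : Fin d₀ => ν 0)
        hf.aemeasurable
      inferInstance
    exact ⟨(measurable_pi_lambda _ fun k => hf.comp (measurable_pi_apply k)).aemeasurable,
      Measure.pi_map_pi fun _ => hf.aemeasurable⟩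
  have h3 := h2.comp h1
  refine h3.congr (.of_forall fun ω => ?_)
  funext k
  exact channel_gcnPreact_zero (fun l => W l ω) k

theorem IsRandomInit.hasLaw_gcnPreact (hW : IsRandomInit P ν L d₀ d W) (hσ : Continuous σ)
    {l : ℕ} (hl : l < L) :
    HasLaw (fun ω (k : Fin (d l)) =>
        channel (gcnPreact A X σ d (fun l => W l ω) (fun _ _ => 0) l) k)
      (netLaw A hσ l (fun j => ⟨ν (j + 1), inferInstance⟩) (fun j => d j)
        (fun _ => .pi fun _ => ⟨firstChannelLaw A X (ν 0), inferInstance⟩) (d l) :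
        Measure _) P := by
  obtain ⟨W', hW', hm, hae⟩ := hW.exists_measurable
  suffices H : HasLaw (fun ω (k : Fin (d l)) =>
        channel (gcnPreact A X σ d (fun l => W' l ω) (fun _ _ => 0) l) k)
      (netLaw A hσ l (fun j => ⟨ν (j + 1), inferInstance⟩) (fun j => d j)
        (fun _ => .pi fun _ => ⟨firstChannelLaw A X (ν 0), inferInstance⟩) (d l) :
        Measure _) P by
    refine H.congr ?_
    filter_upwards [hae] with ω hω
    rw [gcnPreact_congr fun l' hl' => hω l' (hl'.trans_lt hl)]
  clear hae hW
  induction l with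
  | zero => exact hW'.hasLaw_firstLayer hl
  | succ l ih =>
    have h1 := ih (l.lt_succ_self.trans hl)
    have h2 := hasLaw_pi_pi_of_iIndepFun (ν := ν (l + 1))
      (Y := fun i j ω => √(layerWidth d₀ d (l + 1) : ℝ) * W' (l + 1) ω i j)
      (fun i j => hW'.law (l + 1) hl i j) (hW'.iIndepFun_layer hl)
    have := h1.isProbabilityMeasure
    have h3 := (hW'.indepFun_channel (A := A) (X := X) hσ hm hl).hasLaw_prod h1 h2
    have hs := netLaw_succ_last (A := A) hσ l (fun j => ⟨ν (j + 1), inferInstance⟩) d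
      (fun _ => .pi fun _ => ⟨firstChannelLaw A X (ν 0), inferInstance⟩) (d (l + 1))
    have h4 : HasLaw (convMap A σ (d l) (d (l + 1)))
        (convStep A hσ ⟨ν (l + 1), inferInstance⟩ (d l) (d (l + 1))
          (netLaw A hσ l (fun j => ⟨ν (j + 1), inferInstance⟩) (fun j => d j)
            (fun _ => .pi fun _ => ⟨firstChannelLaw A X (ν 0), inferInstance⟩) (d l)) :
          Measure _) _ :=
      ⟨(continuous_convMap hσ _ _).measurable.aemeasurable, rfl⟩
    rw [← hs] at h4
    refine (h4.comp h3).congr (.of_forall fun ω => ?_)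
    exact channel_gcnPreact_succ (fun l => W' l ω) l

end RandomInit

end Network

/-! ### The first layer: moments and the Gaussian case -/

section FirstLayer

variable {V : Type*} [Fintype V] {d₀ : ℕ} {A : Matrix V V ℝ} {X : Matrix V (Fin d₀) ℝ}
  {ν₁ : Measure ℝ} [IsProbabilityMeasure ν₁]

theorem isSymm_normalizedAdj [DecidableEq V] (𝒢 : SimpleGraph V) [DecidableRel 𝒢.Adj] :
    (normalizedAdj 𝒢).IsSymm := by
  rw [IsSymm, normalizedAdj, transpose_mul, transpose_mul, transpose_add, diagonal_transpose,
    SimpleGraph.transpose_adjMatrix, transpose_one, Matrix.mul_assoc]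

theorem firstCov_eq (hA : A.IsSymm) (σw : ℝ) :
    firstCov A X σw = (σw ^ 2 / d₀) • ((A * X) * (A * X)ᵀ) := by
  rw [firstCov, transpose_mul, hA.eq, ← Matrix.mul_assoc]

theorem posSemidef_firstCov (hA : A.IsSymm) (σw : ℝ) : (firstCov A X σw).PosSemidef := by
  rw [firstCov_eq hA]
  exact (posSemidef_self_mul_conjTranspose (A * X)).smul (by positivity)

theorem memLp_eval_firstChannelLaw (hν : MemLp id 2 ν₁) (v : V) :
    MemLp (fun h : EuclideanSpace ℝ V => h v) 2 (firstChannelLaw A X ν₁) := by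
  rw [firstChannelLaw, memLp_map_measure_iff (by fun_prop)
    (measurable_firstChannel _ _).aemeasurable]
  exact (memLp_finsetSum Finset.univ fun j _ =>
    (memLp_eval_pi hν j).const_mul ((A * X) v j)).const_mul (√(d₀ : ℝ))⁻¹

theorem integral_eval_firstChannelLaw (hν : MemLp id 2 ν₁) (hmean : ∫ x, x ∂ν₁ = 0) (v : V) :
    ∫ h, h v ∂(firstChannelLaw A X ν₁) = 0 := by
  rw [firstChannelLaw, integral_map (measurable_firstChannel _ _).aemeasurable (by fun_prop)]
  simp only [Pi.smul_apply, smul_eq_mul, mulVec, dotProduct]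
  rw [integral_const_mul, integral_finsetSum _ fun j _ =>
    ((memLp_eval_pi hν j).integrable one_le_two).const_mul _]
  simp_rw [integral_const_mul, integral_eval (μ := fun _ : Fin d₀ => ν₁), hmean]
  simp

theorem integral_eval_mul_eval_firstChannelLaw (hA : A.IsSymm) {σw : ℝ} (hν : MemLp id 2 ν₁)
    (hmean : ∫ x, x ∂ν₁ = 0) (hvar : variance id ν₁ = σw ^ 2) (u v : V) :
    ∫ h, h u * h v ∂(firstChannelLaw A X ν₁) = firstCov A X σw u v := by
  have hI (i j : Fin d₀) : Integrable (fun ξ : Fin d₀ → ℝ =>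
      (A * X) u i * ξ i * ((A * X) v j * ξ j)) (Measure.pi fun _ => ν₁) :=
    ((memLp_eval_pi hν i).const_mul _).integrable_mul ((memLp_eval_pi hν j).const_mul _)
  have h1 (i j : Fin d₀) : ∫ ξ : Fin d₀ → ℝ, (A * X) u i * ξ i * ((A * X) v j * ξ j)
      ∂(Measure.pi fun _ => ν₁) =
      (A * X) u i * (A * X) v j * if i = j then variance id ν₁ else 0 := by
    rw [← integral_eval_mul_eval_pi hmean, ← integral_const_mul]
    congr 1 with ξ
    ring
  have h2 (ξ : Fin d₀ → ℝ) :
      (√(d₀ : ℝ))⁻¹ * (∑ i, (A * X) u i * ξ i) * ((√(d₀ : ℝ))⁻¹ * ∑ j, (A * X) v j * ξ j) =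
      (d₀ : ℝ)⁻¹ * ∑ i, ∑ j, (A * X) u i * ξ i * ((A * X) v j * ξ j) := by
    rw [← Finset.sum_mul_sum, mul_mul_mul_comm, ← mul_inv, Real.mul_self_sqrt (Nat.cast_nonneg _)]
  rw [firstChannelLaw, integral_map (measurable_firstChannel _ _).aemeasurable (by fun_prop)]
  simp only [Pi.smul_apply, smul_eq_mul, mulVec, dotProduct]
  simp_rw [h2]
  rw [integral_const_mul,
    integral_finsetSum _ fun i _ => integrable_finsetSum _ fun j _ => hI i j]
  simp_rw [fun i => integral_finsetSum (μ := Measure.pi fun _ => ν₁) Finset.univ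
    fun j _ => hI i j, h1, hvar]
  rw [firstCov_eq hA, Matrix.smul_apply, mul_apply, smul_eq_mul]
  simp only [mul_ite, mul_zero, Finset.sum_ite_eq, Finset.mem_univ, if_true, transpose_apply,
    ← Finset.sum_mul]
  ring

/-- A linear image of independent Gaussians is Gaussian: the characteristic function factors over
the inputs `j`, and the exponents add up to the quadratic form of `firstCov`. -/
theorem firstChannelLaw_gaussianReal [DecidableEq V] (hA : A.IsSymm) (σw : ℝ) :
    firstChannelLaw A X (gaussianReal 0 (Real.toNNReal (σw ^ 2))) =
      multivariateGaussian 0 (firstCov A X σw) := by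
  refine Measure.ext_of_charFun (funext fun t => ?_)
  have hpair (ξ : Fin d₀ → ℝ) :
      inner ℝ (WithLp.toLp 2 ((√(d₀ : ℝ))⁻¹ • ((A * X) *ᵥ ξ)) : EuclideanSpace ℝ V) t =
        ∑ j, (√(d₀ : ℝ))⁻¹ * (t ᵥ* (A * X)) j * ξ j := by
    simp only [PiLp.inner_apply, RCLike.inner_apply, conj_trivial, Pi.smul_apply, smul_eq_mul,
      mulVec, vecMul, dotProduct, Finset.mul_sum, Finset.sum_mul]
    rw [Finset.sum_comm]
    refine Finset.sum_congr rfl fun j _ => Finset.sum_congr rfl fun v _ => ?_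
    ring
  have hquad : t.ofLp ⬝ᵥ firstCov A X σw *ᵥ t.ofLp =
      ∑ j, σw ^ 2 * ((√(d₀ : ℝ))⁻¹ * (t.ofLp ᵥ* (A * X)) j) ^ 2 := by
    rw [firstCov_eq hA, smul_mulVec, dotProduct_smul, ← mulVec_mulVec, dotProduct_mulVec,
      mulVec_transpose, dotProduct, smul_eq_mul, Finset.mul_sum]
    refine Finset.sum_congr rfl fun j _ => ?_
    rw [mul_pow, inv_pow, Real.sq_sqrt (Nat.cast_nonneg _)]
    ring
  rw [charFun_multivariateGaussian (posSemidef_firstCov hA σw), hquad, charFun_apply,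
    firstChannelLaw, integral_map (measurable_firstChannel _ _).aemeasurable (by fun_prop)]
  simp_rw [hpair, Complex.ofReal_sum, Finset.sum_mul, Complex.exp_sum]
  rw [integral_fintype_prod_eq_prod (f := fun (j : Fin d₀) (x : ℝ) =>
    Complex.exp (((√(d₀ : ℝ))⁻¹ * (t.ofLp ᵥ* (A * X)) j * x : ℝ) * Complex.I))]
  have hg (a : ℝ) : ∫ x : ℝ, Complex.exp ((a * x : ℝ) * Complex.I)
      ∂(gaussianReal 0 (Real.toNNReal (σw ^ 2))) = Complex.exp (-((σw ^ 2 * a ^ 2 : ℝ) / 2)) := by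
    have h := charFun_gaussianReal (μ := 0) (v := Real.toNNReal (σw ^ 2)) a
    rw [charFun_apply_real] at h
    simp_rw [Complex.ofReal_mul]
    rw [h, Real.coe_toNNReal _ (sq_nonneg _)]
    simp
  simp_rw [hg]
  rw [← Complex.exp_sum]
  simp [Finset.sum_div]

end FirstLayer

/-! ### Covariance recursions and the limit theorem -/

section Recursion

variable {V : Type*} [Fintype V] [DecidableEq V] {d₀ : ℕ} {A : Matrix V V ℝ}
  {X : Matrix V (Fin d₀) ℝ} {σ : ℝ → ℝ} {σw : ℝ}

theorem nngpCovOfLaw_succ {ν₁ : Measure ℝ} {μ : ProbabilityMeasure (EuclideanSpace ℝ V)}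
    (hμ : (μ : Measure _) = firstChannelLaw A X ν₁) (l : ℕ) :
    nngpCovOfLaw A X σ σw ν₁ (l + 1) = convCov A σ σw
      ((convLimit A σ σw)^[l] μ : ProbabilityMeasure _) := by
  induction l with
  | zero => rw [nngpCovOfLaw, ← hμ]; rfl
  | succ l ih =>
    rw [Function.iterate_succ_apply', nngpCovOfLaw, ih]
    rfl

/-- The two recursions can differ only in the step out of layer 1, where the first channel law is
now Gaussian with covariance `firstCov`. -/
theorem nngpCovOfLaw_gaussianReal (hA : A.IsSymm) (l : ℕ) :
    nngpCovOfLaw A X σ σw (gaussianReal 0 (Real.toNNReal (σw ^ 2))) l =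
      nngpCov A X σ σw l := by
  induction l with
  | zero => rfl
  | succ l ih =>
    cases l with
    | zero => rw [nngpCovOfLaw, firstChannelLaw_gaussianReal hA]; rfl
    | succ l => rw [nngpCovOfLaw, ih]; rfl

/-- Transports a law along an equation of widths; having `Q` as a family over all widths allows the
equation to be substituted. -/
theorem hasLaw_comp_finCast {Ω E : Type*} [MeasurableSpace Ω] [MeasurableSpace E] {P : Measure Ω}
    {n m : ℕ} (h : m = n) {Q : (m : ℕ) → Measure (Fin m → E)} {Z : Ω → Fin n → E}
    (hZ : HasLaw Z (Q n) P) : HasLaw (fun ω k => Z ω (Fin.cast h k)) (Q m) P := by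
  subst h
  exact hZ

/-- As the widths of the hidden layers go to infinity one after another, the output channels of a
random graph convolutional network become independent Gaussian vectors. -/
theorem posSemidef_and_seqTendstoInDistribution_gcnPreact (hA : A.IsSymm) (hσ : Continuous σ)
    (hG : ∀ v : NNReal, MemLp σ 2 (gaussianReal 0 v)) {ν : ℕ → Measure ℝ}
    [∀ l, IsProbabilityMeasure (ν l)] (hν : ∀ l, MemLp id 2 (ν l))
    (hmean : ∀ l, ∫ x, x ∂(ν l) = 0) (hvar : ∀ l, variance id (ν l) = σw ^ 2) {L : ℕ}
    {Ω : (ℕ → ℕ) → Type*} [∀ d, MeasurableSpace (Ω d)] {P : (d : ℕ → ℕ) → Measure (Ω d)}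
    {W : (d : ℕ → ℕ) → (l : ℕ) → Ω d →
      Matrix (Fin (layerWidth d₀ d l)) (Fin (layerWidth d₀ d (l + 1))) ℝ}
    (hW : ∀ d, IsRandomInit (P d) ν L d₀ d (W d))
    (hμ : ∀ v, MemLp (fun h : EuclideanSpace ℝ V => σ (h v)) 2 (firstChannelLaw A X (ν 0)))
    {r : ℕ} (hr : 1 ≤ r) (hrL : r < L) (t : ℕ → ℕ) :
    (nngpCovOfLaw A X σ σw (ν 0) r).PosSemidef ∧
    SeqTendstoInDistribution r (fun e => P (splitWidths e t))
      (fun e ω (k : Fin (t r)) =>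
        channel (gcnPreact A X σ (splitWidths e t)
          (fun l => W (splitWidths e t) l ω) (fun _ _ => 0) r)
          (Fin.cast (layerWidth_splitWidths d₀ e t) k))
      (iidGaussian (t r) (nngpCovOfLaw A X σ σw (ν 0) r)) := by
  obtain ⟨l, rfl⟩ : ∃ l, r = l + 1 := ⟨r - 1, by omega⟩
  let μ₁ : ProbabilityMeasure (EuclideanSpace ℝ V) := ⟨firstChannelLaw A X (ν 0), inferInstance⟩
  let ν' : ℕ → ProbabilityMeasure ℝ := fun j => ⟨ν (j + 1), inferInstance⟩
  refine ⟨?_, fun e => netLaw A hσ (l + 1) ν' e (fun _ => .pi fun _ => μ₁) (t (l + 1)),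
    fun e => ?_, ?_⟩
  · rw [nngpCovOfLaw_succ (μ := μ₁) rfl]
    exact posSemidef_convCov (memLp_comp_eval_iterate_convLimit hG hA (μ := μ₁) hμ l) hA σw
  · have h1 := (hW (splitWidths e t)).hasLaw_gcnPreact (A := A) (X := X) hσ hrL
    -- Only the hidden widths enter `netLaw`, and these are exactly `e`.
    have he : (fun j : Fin (l + 1) => splitWidths e t j) = e := by
      funext j
      simp only [splitWidths, j.2, dite_true]
    rw [he] at h1
    let Q (m : ℕ) : Measure (Fin m → EuclideanSpace ℝ V) :=
      (netLaw A hσ (l + 1) ν' e (fun _ => .pi fun _ => μ₁) m : Measure _)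
    exact hasLaw_comp_finCast (n := splitWidths e t (l + 1)) (Q := Q)
      (layerWidth_splitWidths d₀ e t) h1
  · have h1 := seqTendsto_netLaw hσ hG hA (σw := σw) (t (l + 1)) (l + 1) ν'
      (fun j => hν (j + 1)) (fun j => hmean (j + 1)) (fun j => hvar (j + 1)) μ₁ hμ
    have h2 : iidGaussian (t (l + 1)) (nngpCovOfLaw A X σ σw (ν 0) (l + 1)) =
        .pi fun _ => (convLimit A σ σw)^[l + 1] μ₁ := by
      rw [nngpCovOfLaw_succ (μ := μ₁) rfl, Function.iterate_succ_apply']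
      rfl
    rw [h2]
    exact h1

end Recursion

theorem mainTheorem5 {V : Type*} [Fintype V] [DecidableEq V]
    -- the featured graph
    (𝒢 : SimpleGraph V) [DecidableRel 𝒢.Adj] (d₀ : ℕ) (X : Matrix V (Fin d₀) ℝ)
    -- the activation, with finite second moments under all centered Gaussian laws
    (σ : ℝ → ℝ) (hσ : Continuous σ) (hG : ∀ v : NNReal, MemLp σ 2 (gaussianReal 0 v))
    -- the laws of the normalized weights: mean zero and variance `σ_w²`
    (σw : ℝ) (ν : ℕ → Measure ℝ) [∀ l, IsProbabilityMeasure (ν l)]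
    (hν : ∀ l, MemLp id 2 (ν l)) (hmean : ∀ l, ∫ x, x ∂(ν l) = 0)
    (hvar : ∀ l, variance id (ν l) = σw ^ 2)
    -- for all widths of the layers, an `L`-layer network at random initialization
    (L : ℕ) (Ω : (ℕ → ℕ) → Type*) [∀ d, MeasurableSpace (Ω d)] (P : (d : ℕ → ℕ) → Measure (Ω d))
    [∀ d, IsProbabilityMeasure (P d)]
    (W : (d : ℕ → ℕ) → (l : ℕ) → Ω d →
      Matrix (Fin (layerWidth d₀ d l)) (Fin (layerWidth d₀ d (l + 1))) ℝ)
    (hW : ∀ d, IsRandomInit (P d) ν L d₀ d (W d)) :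
    -- Gaussian weights in the first layer
    (ν 0 = gaussianReal 0 (Real.toNNReal (σw ^ 2)) →
      ∀ r : ℕ, 1 ≤ r → r < L → ∀ t : ℕ → ℕ,
        (nngpCov (normalizedAdj 𝒢) X σ σw r).PosSemidef ∧
        SeqTendstoInDistribution r (fun e => P (splitWidths e t))
          (fun e ω (k : Fin (t r)) =>
            channel (gcnPreact (normalizedAdj 𝒢) X σ (splitWidths e t)
              (fun l => W (splitWidths e t) l ω) (fun _ _ => 0) r)
              (Fin.cast (layerWidth_splitWidths d₀ e t) k))
          (iidGaussian (t r) (nngpCov (normalizedAdj 𝒢) X σ σw r))) ∧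
    -- weights of any law in the first layer
    ((∀ v, MemLp (fun h : EuclideanSpace ℝ V => σ (h v)) 2
        (firstChannelLaw (normalizedAdj 𝒢) X (ν 0))) →
      ∀ r : ℕ, 1 ≤ r → r < L → ∀ t : ℕ → ℕ,
        (nngpCovOfLaw (normalizedAdj 𝒢) X σ σw (ν 0) r).PosSemidef ∧
        SeqTendstoInDistribution r (fun e => P (splitWidths e t))
          (fun e ω (k : Fin (t r)) =>
            channel (gcnPreact (normalizedAdj 𝒢) X σ (splitWidths e t)
              (fun l => W (splitWidths e t) l ω) (fun _ _ => 0) r)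
              (Fin.cast (layerWidth_splitWidths d₀ e t) k))
          (iidGaussian (t r) (nngpCovOfLaw (normalizedAdj 𝒢) X σ σw (ν 0) r))) ∧
    -- the channels of the first layer: independent, same law, mean zero and covariance `Σ⁽¹⁾`
    (1 ≤ L → ∀ d : ℕ → ℕ,
      HasLaw (fun ω (k : Fin (layerWidth d₀ d 1)) =>
          channel (gcnPreact (normalizedAdj 𝒢) X σ d (fun l => W d l ω) (fun _ _ => 0) 0) k)
        (Measure.pi (fun _ => firstChannelLaw (normalizedAdj 𝒢) X (ν 0))) (P d)) ∧
    (∀ u v, MemLp (fun h : EuclideanSpace ℝ V => h v) 2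
        (firstChannelLaw (normalizedAdj 𝒢) X (ν 0)) ∧
      ∫ h, h v ∂(firstChannelLaw (normalizedAdj 𝒢) X (ν 0)) = 0 ∧
      ∫ h, h u * h v ∂(firstChannelLaw (normalizedAdj 𝒢) X (ν 0)) =
        firstCov (normalizedAdj 𝒢) X σw u v) := by

  have hA := isSymm_normalizedAdj 𝒢
  refine ⟨fun hν0 r hr hrL t => ?_, fun hμ r hr hrL t => ?_, fun hL d => ?_, fun u v => ?_⟩
  -- With Gaussian first weights, the moment condition of part 2 follows from the one on `σ`.
  · have hμ (v : V) : MemLp (fun h : EuclideanSpace ℝ V => σ (h v)) 2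
        (firstChannelLaw (normalizedAdj 𝒢) X (ν 0)) := by
      rw [hν0, firstChannelLaw_gaussianReal hA]
      exact memLp_comp_eval_multivariateGaussian hG (posSemidef_firstCov hA σw) v
    have := posSemidef_and_seqTendstoInDistribution_gcnPreact hA hσ hG hν hmean hvar hW hμ hr hrL t
    rwa [hν0, nngpCovOfLaw_gaussianReal hA] at this
  · exact posSemidef_and_seqTendstoInDistribution_gcnPreact hA hσ hG hν hmean hvar hW hμ hr hrL t
  · exact (hW d).hasLaw_firstLayer hL
  · exact ⟨memLp_eval_firstChannelLaw (hν 0) v, integral_eval_firstChannelLaw (hν 0) (hmean 0) v,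
      integral_eval_mul_eval_firstChannelLaw hA (hν 0) (hmean 0) (hvar 0) u v⟩
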